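/- **Setting.** Names are de Bruijn indices; a context $\Gamma$ is a natural number, with names $x<\Gamma$. Processes of the synchronous monadic $\pi$-calculus are $$P ::= 0 \mid \underline{x}.P \mid \bar x\langle y\rangle.P \mid P+Q \mid P\mid Q\mid \nu P\mid\, !P ,$$ where $\underline{x}.P$ (input) and $\nu P$ bind the name $0$ in $P$; $\Gamma\vdash P$ means that all free names of $P$ are $<\Gamma$. Renamings act as usual, $\rho+1$ being the renaming used under a binder ($0\mapsto 0$, $x+1\mapsto \rho x+1$) and $\rho+\Delta$ its $\Delta$-fold iterate. Put $\mathsf{push}(x)=x+1$; $\mathsf{pop}_y(0)=y$, $\mathsf{pop}_y(x+1)=x$; $\mathsf{swap}$ exchanges $0$ and $1$. Actions are $a::=\underline{x}\mid\bar x\mid\bar x\langle y\rangle\mid\tau$; inputs $\underline{x}$ and bound outputs $\bar x$ are *bound* actions ($|a|=1$), the others not ($|a|=0$). Write $\mathsf{push}_aP$ for $\mathsf{push}\,P$ if $a$ is bound and for $P$ otherwise; similarly $\mathsf{swap}_aP$. The same notation is used for transitions and braids, to which renamings extend compositionally. **Transitions** are derivations $t: P\xrightarrow{a}R$ built by the following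 rules (the term for the derivation is given first). * $\underline{x}.P:\ \underline{x}.P\xrightarrow{\underline{x}}P$ and $\bar x\langle y\rangle.P:\ \bar x\langle y\rangle.P\xrightarrow{\bar x\langle y\rangle}P$. * If $t:P\xrightarrow{a}R$ then $t+Q: P+Q\xrightarrow{a}R$ and $t\mid Q: P\mid Q\xrightarrow{a}R\mid\mathsf{push}_aQ$; symmetrically $P+u$ and $P\mid u$. * If $t:P\xrightarrow{\underline{x}}R$ and $u:Q\xrightarrow{\bar x\langle y\rangle}S$ then $t\mid_y u: P\mid Q\xrightarrow{\tau}\mathsf{pop}_yR\mid S$; if $u:Q\xrightarrow{\bar x}S$ then $t\mid_\nu u:P\mid Q\xrightarrow{\tau}\nu(R\mid S)$; symmetrically with the sender on the left (these are different terms; the sender of a synchronisation is part of the term). * If $t:P\xrightarrow{\overline{x+1}\langle 0\rangle}R$ then $\bar\nu t:\nu P\xrightarrow{\bar x}R$. * If $t:P\xrightarrow{\mathsf{push}\,a}R$ then $\nu t:\nu P\xrightarrow{a}\nu(\mathsf{swap}_aR)$. * If $t:P\mid{!P}\xrightarrow{a}R$ then $!t:{!P}\xrightarrow{a}R$. **Concurrency**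 $t\smile t'$, for transitions with the same source, is the smallest symmetric relation such that: $P\mid u\smile t\mid Q$ always; and if $t\smile t'$ and $u\smile u'$, then $t+Q\smile t'+Q$; $P+u\smile P+u'$; $t\mid Q\smile t'\mid Q$; $P\mid u\smile P\mid u'$; $t\mid Q\smile t'\,\|\,w$; $P\mid u\smile w\,\|\,u'$; $t\,\|\,u\smile t'\,\|'\,u'$; $\bar\nu t\smile\bar\nu t'$; $\bar\nu t\smile\nu t'$; $\nu t\smile\nu t'$; $!t\smile{!t'}$. Here $w$ is any transition and $\|,\|'$ are any synchronisations, plain or $\nu$, in either direction. **Residuals.** For $t\smile t'$ the residual $t/t'$, a transition starting at the target of $t'$, is defined by recursion. Write $a_t$ for the action and $\mathrm{tgt}\,t$ for the target of $t$; $\mathsf{rcv}$ applied to the receiving component of a plain synchronisation $t'\mid_y u'$ stands for $\mathsf{pop}_y$, and applied to the sending component for the identity. * $(P\mid u)/(t\mid Q)=\mathrm{tgt}\,t\mid\mathsf{push}_{a_t}u$ and $(t\mid Q)/(P\mid u)=\mathsf{push}_{a_u}t\mid\mathrm{tgt}\,u$. * $(t+Q)/(t'+Q)=t/t'$; $(t\mid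 Q)/(t'\mid Q)=(t/t')\mid\mathsf{push}_{a_{t'}}Q$; symmetrically on the right. * $(t\mid Q)/(t'\mid_y u')=\mathsf{rcv}(t/t')\mid\mathsf{rcv}(\mathrm{tgt}\,u')$; $(t\mid Q)/(t'\mid_\nu u')=\mathsf{cl}\big((t/t')\mid\mathrm{tgt}\,u'\big)$, where $\mathsf{cl}(v)$ is $\bar\nu v$ if $v$ outputs the name $0$ on a channel $x+1$, and $\nu v$ otherwise; symmetrically on the right. * $(t\,\|\,u)/(t'\mid Q)=(t/t')\,\|^*\,\mathsf{push}_{a_{t'}}u$, symmetrically on the right; $(t\,\|\,u)/(t'\mid_y u')=\mathsf{rcv}(t/t')\,\|\,\mathsf{rcv}(u/u')$; $(t\,\|\,u)/(t'\mid_\nu u')=\nu\big((t/t')\,\|^*\,(u/u')\big)$. Here $\|^*$ has the same direction as $\|$, is a $\nu$-synchronisation if the sender's residual is a bound output and is plain if it is an ordinary output. * $\bar\nu t/\bar\nu t'=t/t'$; $\bar\nu t/\nu t'=\bar\nu(\mathsf{swap}_{a_{t'}}(t/t'))$; $\nu t/\bar\nu t'=t/t'$; $\nu t/\nu t'=\nu(\mathsf{swap}_{a_{t'}}(t/t'))$;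 $!t/!t'=t/t'$. **Braidings.** A *free braid* $\mathsf{free}_\Delta(R)$ relates $(\mathsf{swap}+\Delta)R$ to $R$. *Bound braids* $\phi:P\rtimes R$ are generated by: $\nu\nu_R:\nu\nu(\mathsf{swap}\,R)\rtimes\nu\nu R$; reflexivity at $0$, $\underline{x}.P$ and $\bar x\langle y\rangle.P$; and, given $\phi:P\rtimes R$ and $\psi:Q\rtimes S$, $\phi+Q:P+Q\rtimes R+Q$, $P+\psi:P+Q\rtimes P+S$, $\phi\mid\psi:P\mid Q\rtimes R\mid S$, $\nu\phi:\nu P\rtimes\nu R$, $!\phi:{!P}\rtimes{!R}$. Every process $P$ has a reflexivity bound braid $\mathrm{id}_P$ (at a sum, $\mathrm{id}_P+Q$; otherwise compositionally). A *braiding* is a free or a bound braid. For $t\smile t'$, a *braiding of $t,t'$* is a braiding $\gamma$ from $\mathrm{tgt}(t'/t)$ to $\mathrm{tgt}(t/t')$ which is a free braid with $\Delta=0$ if both $t/t'$ and $t'/t$ have bound actions, and a bound braid (equality being included through reflexivity) otherwise. **Transport.** For a braiding $\gamma$ and a transition $t$ that starts at its left-hand side, $t/\gamma$ is a transition that starts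 at its right-hand side, and $\gamma/t$ is a braiding from $\mathrm{tgt}\,t$ to $\mathrm{tgt}(t/\gamma)$. For $\gamma=\mathsf{free}_\Delta(R)$: $t/\gamma=(\mathsf{swap}+\Delta)t$ and $\gamma/t$ is the free braid with $\Delta+|a_t|$ whose right-hand side is $(\mathsf{swap}+\Delta+|a_t|)\,\mathrm{tgt}\,t$. For bound braids: * $\bar\nu\nu t/\nu\nu_R=\nu\bar\nu(\mathsf{swap}\,t)$, $\nu\bar\nu t/\nu\nu_R=\bar\nu\nu(\mathsf{swap}\,t)$, $\nu\nu t/\nu\nu_R=\nu\nu(\mathsf{swap}\,t)$; the residual of $\nu\nu_R$ after $\bar\nu\nu t$ or $\nu\bar\nu t$ is a reflexivity braid, and after $\nu\nu t$ it is again an instance of the rule $\nu\nu$. * The residual of a prefix after its reflexivity braid is the same transition, and that braid after the transition is $\mathrm{id}$ of the target. * $(t+Q)/(\phi+Q)=(t/\phi)+Q$ and $(\phi+Q)/(t+Q)=\phi/t$; $(t+Q)/(P+\psi)=t+S$ and $(P+\psi)/(t+Q)=\mathrm{id}_{\mathrm{tgt}\,t}$; symmetrically on the right. * $(t\mid Q)/(\phi\mid\psi)=(t/\phi)\mid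 S$ and $(\phi\mid\psi)/(t\mid Q)=(\phi/t)\mid\mathsf{push}_{a_t}\psi$; symmetrically on the right; $(t\,\|\,u)/(\phi\mid\psi)=(t/\phi)\,\|\,(u/\psi)$, with $(\phi\mid\psi)/(t\mid_yu)=\mathsf{rcv}(\phi/t)\mid\mathsf{rcv}(\psi/u)$ and $(\phi\mid\psi)/(t\mid_\nu u)=\nu\big((\phi/t)\mid(\psi/u)\big)$. * $\bar\nu t/\nu\phi=\bar\nu(t/\phi)$ and $\nu\phi/\bar\nu t=\phi/t$; $\nu t/\nu\phi=\nu(t/\phi)$ and $\nu\phi/\nu t=\nu(\mathsf{swap}_{a_t}(\phi/t))$; $!t/!\phi={!\big(t/(\phi\mid{!\phi})\big)}$ and $!\phi/!t=(\phi\mid{!\phi})/t$. **Traces** are finite sequences of composable transitions: the empty trace $\varepsilon_P$ at $P$, and $t\cdot\vec t$ with $t:P\xrightarrow{a}R$ and $\vec t$ a trace from $R$. Transport extends to traces by $\varepsilon_P/\gamma=\varepsilon_{P'}$, with $P'$ the right-hand side of $\gamma$, and $(t\cdot\vec t)/\gamma=(t/\gamma)\cdot\big(\vec t/(\gamma/t)\big)$.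 **Causal equivalence** $\simeq$ is the relation on traces defined inductively by * $\varepsilon_P\simeq\varepsilon_P$; * if $\vec t\simeq\vec u$ then $t\cdot\vec t\simeq t\cdot\vec u$, for $t$ composable with $\vec t$ and with $\vec u$; * if $t\smile t'$, $\gamma$ is a braiding of $t,t'$ and $\vec t$ is a trace from $\mathrm{tgt}(t'/t)$, then $t\cdot(t'/t)\cdot\vec t\ \simeq\ t'\cdot(t/t')\cdot(\vec t/\gamma)$; * if $\vec t\simeq\vec u$ and $\vec u\simeq\vec v$ then $\vec t\simeq\vec v$. **Theorem.** For every context $\Gamma$, causal equivalence $\simeq$ is an equivalence relation on the traces that start at processes $P$ with $\Gamma\vdash P$. -/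

import Mathlib

namespace PiCalculus

/-! ### Names and renamings

Names are de Bruijn indices. A context `Γ` is a natural number; the names in `Γ` are those `x < Γ`.
Renamings are total functions on indices. -/

/-- `push` makes room for a new name `0`. -/
def push (x : ℕ) : ℕ := x + 1

/-- `pop y` undoes `push`, replacing the name `0` by `y`. -/
def pop (y : ℕ) : ℕ → ℕ
  | 0 => y
  | x + 1 => x

/-- `swap` transposes the names `0` and `1`. -/
def swap : ℕ → ℕ
  | 0 => 1
  | 1 => 0
  | x + 2 => x + 2

/-- The renaming `ρ + 1` used under a binder. -/
def lift (ρ : ℕ → ℕ) : ℕ → ℕ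
  | 0 => 0
  | x + 1 => ρ x + 1

/-- The renaming `ρ + Δ` used under `Δ` binders. -/
def liftN (ρ : ℕ → ℕ) : ℕ → ℕ → ℕ
  | 0 => ρ
  | Δ + 1 => lift (liftN ρ Δ)

/-! ### Actions and processes -/

/-- Actions: input `x`, bound output `x̄`, output `x̄⟨y⟩`, and the silent action. -/
inductive Act : Type
  | inp (x : ℕ)
  | bout (x : ℕ)
  | out (x y : ℕ)
  | tau

/-- The action of a renaming on actions. -/
def Act.ren (ρ : ℕ → ℕ) : Act → Act
  | inp x => inp (ρ x)
  | bout x => bout (ρ x)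
  | out x y => out (ρ x) (ρ y)
  | tau => tau

/-- Inputs and bound outputs are the bound actions. -/
def Act.isBound : Act → Bool
  | inp _ => true
  | bout _ => true
  | out _ _ => false
  | tau => false

/-- The number `|a|` of names by which an action extends the context. -/
def Act.size (a : Act) : ℕ := if a.isBound then 1 else 0

/-- The name sent by an output action (a dummy value for the other actions). -/
def Act.sent : Act → ℕ
  | out _ y => y
  | _ => 0

/-- Raw processes of the synchronous monadic π-calculus, over all de Bruijn indices.
`inp x P` and `nu P` bind the index `0` in `P`. -/
inductive Proc : Type
  | zero
  | inp (x : ℕ) (P : Proc)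
  | out (x y : ℕ) (P : Proc)
  | sum (P Q : Proc)
  | par (P Q : Proc)
  | nu (P : Proc)
  | rep (P : Proc)

/-- `P.ClosedBy Γ` is the judgement `Γ ⊢ P`: every free name of `P` is in `Γ`. -/
def Proc.ClosedBy : Proc → ℕ → Prop
  | zero, _ => True
  | inp x P, Γ => x < Γ ∧ P.ClosedBy (Γ + 1)
  | out x y P, Γ => x < Γ ∧ y < Γ ∧ P.ClosedBy Γ
  | sum P Q, Γ => P.ClosedBy Γ ∧ Q.ClosedBy Γ
  | par P Q, Γ => P.ClosedBy Γ ∧ Q.ClosedBy Γ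
  | nu P, Γ => P.ClosedBy (Γ + 1)
  | rep P, Γ => P.ClosedBy Γ

/-- The action of a renaming on processes. -/
def Proc.ren : (ℕ → ℕ) → Proc → Proc
  | _, zero => zero
  | ρ, inp x P => inp (ρ x) (P.ren (lift ρ))
  | ρ, out x y P => out (ρ x) (ρ y) (P.ren ρ)
  | ρ, sum P Q => sum (P.ren ρ) (Q.ren ρ)
  | ρ, par P Q => par (P.ren ρ) (Q.ren ρ)
  | ρ, nu P => nu (P.ren (lift ρ))
  | ρ, rep P => rep (P.ren ρ)

/-- Push a process past an action: `push` is applied exactly if the action is bound. -/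
def Proc.pushBy (a : Act) (P : Proc) : Proc := if a.isBound then P.ren push else P

/-- Apply `swap` to a process exactly if the action is bound. -/
def Proc.swapBy (a : Act) (P : Proc) : Proc := if a.isBound then P.ren swap else P

/-! ### Transitions

Transitions are derivations of the labelled transition relation. They are represented by proof terms,
with one constructor for each rule, and a judgement `t.Derives P a R` which says that the term `t` is
a derivation of `P —a→ R`. -/

/-- Proof terms for transitions. In `comL`, `nuComL` (`comR`, `nuComR`) the left (right) component is
the receiver. -/
inductive Trans : Type
  | inp (x : ℕ) (P : Proc)
  | out (x y : ℕ) (P : Proc)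
  | sumL (t : Trans) (Q : Proc)
  | sumR (P : Proc) (u : Trans)
  | parL (t : Trans) (Q : Proc)
  | parR (P : Proc) (u : Trans)
  | comL (t u : Trans)
  | comR (t u : Trans)
  | nuComL (t u : Trans)
  | nuComR (t u : Trans)
  | opn (t : Trans)
  | nu (t : Trans)
  | rep (t : Trans)

/-- `t.Derives P a R`: the term `t` is a derivation of the transition `P —a→ R`. The two variants of the
rules for propagation through a parallel composition or a restriction (bound and non-bound actions)
are written as one, using `pushBy` and `swapBy`. -/
inductive Trans.Derives : Trans → Proc → Act → Proc → Prop
  | inp (x : ℕ) (P : Proc) : Derives (.inp x P) (.inp x P) (.inp x) P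
  | out (x y : ℕ) (P : Proc) : Derives (.out x y P) (.out x y P) (.out x y) P
  | sumL {t : Trans} {P R : Proc} {a : Act} (Q : Proc) :
      Derives t P a R → Derives (.sumL t Q) (.sum P Q) a R
  | sumR {u : Trans} {Q S : Proc} {a : Act} (P : Proc) :
      Derives u Q a S → Derives (.sumR P u) (.sum P Q) a S
  | parL {t : Trans} {P R : Proc} {a : Act} (Q : Proc) :
      Derives t P a R → Derives (.parL t Q) (.par P Q) a (.par R (Q.pushBy a))
  | parR {u : Trans} {Q S : Proc} {a : Act} (P : Proc) :
      Derives u Q a S → Derives (.parR P u) (.par P Q) a (.par (P.pushBy a) S)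
  | comL {t u : Trans} {P Q R S : Proc} {x y : ℕ} :
      Derives t P (.inp x) R → Derives u Q (.out x y) S →
      Derives (.comL t u) (.par P Q) .tau (.par (R.ren (pop y)) S)
  | comR {t u : Trans} {P Q R S : Proc} {x y : ℕ} :
      Derives t P (.out x y) R → Derives u Q (.inp x) S →
      Derives (.comR t u) (.par P Q) .tau (.par R (S.ren (pop y)))
  | nuComL {t u : Trans} {P Q R S : Proc} {x : ℕ} :
      Derives t P (.inp x) R → Derives u Q (.bout x) S →
      Derives (.nuComL t u) (.par P Q) .tau (.nu (.par R S))
  | nuComR {t u : Trans} {P Q R S : Proc} {x : ℕ} :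
      Derives t P (.bout x) R → Derives u Q (.inp x) S →
      Derives (.nuComR t u) (.par P Q) .tau (.nu (.par R S))
  | opn {t : Trans} {P R : Proc} {x : ℕ} :
      Derives t P (.out (x + 1) 0) R → Derives (.opn t) (.nu P) (.bout x) R
  | nu {t : Trans} {P R : Proc} {a : Act} :
      Derives t P (a.ren push) R → Derives (.nu t) (.nu P) a (.nu (R.swapBy a))
  | rep {t : Trans} {P R : Proc} {a : Act} :
      Derives t (.par P (.rep P)) a R → Derives (.rep t) (.rep P) a R

/-- The action of a transition; see `Trans.Derives.act_eq`. -/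
def Trans.act : Trans → Act
  | inp x _ => .inp x
  | out x y _ => .out x y
  | sumL t _ => t.act
  | sumR _ u => u.act
  | parL t _ => t.act
  | parR _ u => u.act
  | comL _ _ => .tau
  | comR _ _ => .tau
  | nuComL _ _ => .tau
  | nuComR _ _ => .tau
  | opn t => match t.act with
    | .out x _ => .bout (pop 0 x)
    | a => a
  | nu t => t.act.ren (pop 0)
  | rep t => t.act

/-- The target of a transition; see `Trans.Derives.tgt_eq`. -/
def Trans.tgt : Trans → Proc
  | inp _ P => P
  | out _ _ P => P
  | sumL t _ => t.tgt
  | sumR _ u => u.tgt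
  | parL t Q => .par t.tgt (Q.pushBy t.act)
  | parR P u => .par (P.pushBy u.act) u.tgt
  | comL t u => .par (t.tgt.ren (pop u.act.sent)) u.tgt
  | comR t u => .par t.tgt (u.tgt.ren (pop t.act.sent))
  | nuComL t u => .nu (.par t.tgt u.tgt)
  | nuComR t u => .nu (.par t.tgt u.tgt)
  | opn t => t.tgt
  | nu t => .nu (t.tgt.swapBy t.act)
  | rep t => t.tgt

theorem Act.ren_pop_push (a : Act) : (a.ren push).ren (pop 0) = a := by
  cases a <;> rfl

theorem Act.isBound_ren (ρ : ℕ → ℕ) (a : Act) : (a.ren ρ).isBound = a.isBound := by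
  cases a <;> rfl

theorem Trans.Derives.act_eq_and_tgt_eq {t : Trans} {P R : Proc} {a : Act}
    (h : t.Derives P a R) : t.act = a ∧ t.tgt = R := by
  induction h <;>
    simp_all [Trans.act, Trans.tgt, Act.ren_pop_push, pop, Act.sent, Proc.swapBy, Act.isBound_ren]

theorem Trans.Derives.act_eq {t : Trans} {P R : Proc} {a : Act} (h : t.Derives P a R) :
    t.act = a := h.act_eq_and_tgt_eq.1

theorem Trans.Derives.tgt_eq {t : Trans} {P R : Proc} {a : Act} (h : t.Derives P a R) :
    t.tgt = R := h.act_eq_and_tgt_eq.2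

/-- The action of a renaming on transitions. -/
def Trans.ren : (ℕ → ℕ) → Trans → Trans
  | ρ, inp x P => inp (ρ x) (P.ren (lift ρ))
  | ρ, out x y P => out (ρ x) (ρ y) (P.ren ρ)
  | ρ, sumL t Q => sumL (t.ren ρ) (Q.ren ρ)
  | ρ, sumR P u => sumR (P.ren ρ) (u.ren ρ)
  | ρ, parL t Q => parL (t.ren ρ) (Q.ren ρ)
  | ρ, parR P u => parR (P.ren ρ) (u.ren ρ)
  | ρ, comL t u => comL (t.ren ρ) (u.ren ρ)
  | ρ, comR t u => comR (t.ren ρ) (u.ren ρ)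
  | ρ, nuComL t u => nuComL (t.ren ρ) (u.ren ρ)
  | ρ, nuComR t u => nuComR (t.ren ρ) (u.ren ρ)
  | ρ, opn t => opn (t.ren (lift ρ))
  | ρ, nu t => nu (t.ren (lift ρ))
  | ρ, rep t => rep (t.ren ρ)

/-- Push a transition past an action. -/
def Trans.pushBy (a : Act) (t : Trans) : Trans := if a.isBound then t.ren push else t

/-- Apply `swap` to a transition exactly if the action is bound. -/
def Trans.swapBy (a : Act) (t : Trans) : Trans := if a.isBound then t.ren swap else t

/-! ### Concurrent transitions -/

/-- The rules for concurrency of transitions, closed under symmetry. -/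
inductive Trans.Conc : Trans → Trans → Prop
  | symm {t t' : Trans} : Conc t t' → Conc t' t
  | parR_parL (P Q : Proc) (t u : Trans) : Conc (.parR P u) (.parL t Q)
  | parL_comL {t t' : Trans} (Q : Proc) (u : Trans) : Conc t t' → Conc (.parL t Q) (.comL t' u)
  | parL_comR {t t' : Trans} (Q : Proc) (u : Trans) : Conc t t' → Conc (.parL t Q) (.comR t' u)
  | parR_comL {u u' : Trans} (P : Proc) (t : Trans) : Conc u u' → Conc (.parR P u) (.comL t u')
  | parR_comR {u u' : Trans} (P : Proc) (t : Trans) : Conc u u' → Conc (.parR P u) (.comR t u')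
  | parL_nuComL {t t' : Trans} (Q : Proc) (u : Trans) :
      Conc t t' → Conc (.parL t Q) (.nuComL t' u)
  | parL_nuComR {t t' : Trans} (Q : Proc) (u : Trans) :
      Conc t t' → Conc (.parL t Q) (.nuComR t' u)
  | parR_nuComL {u u' : Trans} (P : Proc) (t : Trans) :
      Conc u u' → Conc (.parR P u) (.nuComL t u')
  | parR_nuComR {u u' : Trans} (P : Proc) (t : Trans) :
      Conc u u' → Conc (.parR P u) (.nuComR t u')
  | sumL {t t' : Trans} (Q : Proc) : Conc t t' → Conc (.sumL t Q) (.sumL t' Q)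
  | sumR {u u' : Trans} (P : Proc) : Conc u u' → Conc (.sumR P u) (.sumR P u')
  | parR {u u' : Trans} (P : Proc) : Conc u u' → Conc (.parR P u) (.parR P u')
  | parL {t t' : Trans} (Q : Proc) : Conc t t' → Conc (.parL t Q) (.parL t' Q)
  | comL_comL {t t' u u' : Trans} : Conc t t' → Conc u u' → Conc (.comL t u) (.comL t' u')
  | comR_comR {t t' u u' : Trans} : Conc t t' → Conc u u' → Conc (.comR t u) (.comR t' u')
  | comL_comR {t t' u u' : Trans} : Conc t t' → Conc u u' → Conc (.comL t u) (.comR t' u')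
  | comL_nuComL {t t' u u' : Trans} : Conc t t' → Conc u u' → Conc (.comL t u) (.nuComL t' u')
  | comR_nuComL {t t' u u' : Trans} : Conc t t' → Conc u u' → Conc (.comR t u) (.nuComL t' u')
  | comL_nuComR {t t' u u' : Trans} : Conc t t' → Conc u u' → Conc (.comL t u) (.nuComR t' u')
  | comR_nuComR {t t' u u' : Trans} : Conc t t' → Conc u u' → Conc (.comR t u) (.nuComR t' u')
  | nuComL_nuComL {t t' u u' : Trans} :
      Conc t t' → Conc u u' → Conc (.nuComL t u) (.nuComL t' u')
  | nuComR_nuComR {t t' u u' : Trans} :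
      Conc t t' → Conc u u' → Conc (.nuComR t u) (.nuComR t' u')
  | nuComL_nuComR {t t' u u' : Trans} :
      Conc t t' → Conc u u' → Conc (.nuComL t u) (.nuComR t' u')
  | opn {t t' : Trans} : Conc t t' → Conc (.opn t) (.opn t')
  | opn_nu {t t' : Trans} : Conc t t' → Conc (.opn t) (.nu t')
  | nu {t t' : Trans} : Conc t t' → Conc (.nu t) (.nu t')
  | rep {t t' : Trans} : Conc t t' → Conc (.rep t) (.rep t')

/-- `Trans.Concurrent P t t'` is `t ⌣ t'` for transitions `t` and `t'` that both start at `P`. -/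
def Trans.Concurrent (P : Proc) (t t' : Trans) : Prop :=
  (∃ a R, t.Derives P a R) ∧ (∃ a' R', t'.Derives P a' R') ∧ Conc t t'

/-! ### Residuals of concurrent transitions -/

/-- Propagate a transition through a `ν`: an output `(x+1)⟨0⟩` of the bound name initiates an extrusion,
any other transition is propagated unchanged. -/
def Trans.close (t : Trans) : Trans :=
  match t.act with
  | .out (_ + 1) 0 => .opn t
  | _ => .nu t

/-- Synchronise a receiver on the left with a sender on the right, by a `ν`-synchronisation if the
output is bound and by a plain one otherwise. -/
def Trans.syncL (t u : Trans) : Trans := if u.act.isBound then .nuComL t u else .comL t u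

/-- Synchronise a sender on the left with a receiver on the right. -/
def Trans.syncR (t u : Trans) : Trans := if t.act.isBound then .nuComR t u else .comR t u

/-- `res t t'` is the residual `t / t'` of `t` after `t'`. It is meaningful for concurrent `t`, `t'` only;
other pairs get a dummy value. The bound and non-bound variants of an equation are written as one. -/
def Trans.res : Trans → Trans → Trans
  | parR _ u, parL t _ => parR t.tgt (u.pushBy t.act)
  | parL t _, parR _ u => parL (t.pushBy u.act) u.tgt
  | sumL t _, sumL t' _ => res t t'
  | sumR _ u, sumR _ u' => res u u'
  | parL t Q, parL t' _ => parL (res t t') (Q.pushBy t'.act)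
  | parR P u, parR _ u' => parR (P.pushBy u'.act) (res u u')
  | parL t _, comL t' u => parL ((res t t').ren (pop u.act.sent)) u.tgt
  | parL t _, comR t' u => parL (res t t') (u.tgt.ren (pop t'.act.sent))
  | parR _ u, comL t u' => parR (t.tgt.ren (pop u'.act.sent)) (res u u')
  | parR _ u, comR t u' => parR t.tgt ((res u u').ren (pop t.act.sent))
  | parL t _, nuComL t' u => close (parL (res t t') u.tgt)
  | parL t _, nuComR t' u => close (parL (res t t') u.tgt)
  | parR _ u, nuComL t u' => close (parR t.tgt (res u u'))
  | parR _ u, nuComR t u' => close (parR t.tgt (res u u'))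
  | comL t u, parL t' _ => comL (res t t') (u.pushBy t'.act)
  | comR t u, parL t' _ => comR (res t t') (u.pushBy t'.act)
  | comL t u, parR _ u' => comL (t.pushBy u'.act) (res u u')
  | comR t u, parR _ u' => comR (t.pushBy u'.act) (res u u')
  | nuComL t u, parL t' _ => nuComL (res t t') (u.pushBy t'.act)
  | nuComR t u, parL t' _ => syncR (res t t') (u.pushBy t'.act)
  | nuComL t u, parR _ u' => syncL (t.pushBy u'.act) (res u u')
  | nuComR t u, parR _ u' => nuComR (t.pushBy u'.act) (res u u')
  | comL t u, comL t' u' => comL ((res t t').ren (pop u'.act.sent)) (res u u')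
  | comL t u, comR t' u' => comL (res t t') ((res u u').ren (pop t'.act.sent))
  | comR t u, comL t' u' => comR ((res t t').ren (pop u'.act.sent)) (res u u')
  | comR t u, comR t' u' => comR (res t t') ((res u u').ren (pop t'.act.sent))
  | comL t u, nuComL t' u' => nu (comL (res t t') (res u u'))
  | comL t u, nuComR t' u' => nu (comL (res t t') (res u u'))
  | comR t u, nuComL t' u' => nu (comR (res t t') (res u u'))
  | comR t u, nuComR t' u' => nu (comR (res t t') (res u u'))
  | nuComL t u, comL t' u' => nuComL ((res t t').ren (pop u'.act.sent)) (res u u')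
  | nuComL t u, comR t' u' => nuComL (res t t') ((res u u').ren (pop t'.act.sent))
  | nuComR t u, comL t' u' => nuComR ((res t t').ren (pop u'.act.sent)) (res u u')
  | nuComR t u, comR t' u' => nuComR (res t t') ((res u u').ren (pop t'.act.sent))
  | nuComL t u, nuComL t' u' => nu (syncL (res t t') (res u u'))
  | nuComL t u, nuComR t' u' => nu (syncL (res t t') (res u u'))
  | nuComR t u, nuComL t' u' => nu (syncR (res t t') (res u u'))
  | nuComR t u, nuComR t' u' => nu (syncR (res t t') (res u u'))
  | opn t, opn t' => res t t'
  | opn t, nu t' => opn ((res t t').swapBy t'.act)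
  | nu t, opn t' => res t t'
  | nu t, nu t' => nu ((res t t').swapBy t'.act)
  | rep t, rep t' => res t t'
  | t, _ => t

/-! ### Braidings -/

/-- Proof terms for bound braids. `nuSwap R` is the rule that relates `νν(swap R)` to `ννR`; the other
constructors are named after the process constructor they go through. -/
inductive BoundBraid : Type
  | nuSwap (R : Proc)
  | zero
  | inp (x : ℕ) (P : Proc)
  | out (x y : ℕ) (P : Proc)
  | sumL (φ : BoundBraid) (Q : Proc)
  | sumR (P : Proc) (ψ : BoundBraid)
  | par (φ ψ : BoundBraid)
  | nu (φ : BoundBraid)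
  | rep (φ : BoundBraid)

/-- The left-hand side of a bound braid. -/
def BoundBraid.src : BoundBraid → Proc
  | nuSwap R => .nu (.nu (R.ren swap))
  | zero => .zero
  | inp x P => .inp x P
  | out x y P => .out x y P
  | sumL φ Q => .sum φ.src Q
  | sumR P ψ => .sum P ψ.src
  | par φ ψ => .par φ.src ψ.src
  | nu φ => .nu φ.src
  | rep φ => .rep φ.src

/-- The right-hand side of a bound braid. -/
def BoundBraid.tgt : BoundBraid → Proc
  | nuSwap R => .nu (.nu R)
  | zero => .zero
  | inp x P => .inp x P
  | out x y P => .out x y P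
  | sumL φ Q => .sum φ.tgt Q
  | sumR P ψ => .sum P ψ.tgt
  | par φ ψ => .par φ.tgt ψ.tgt
  | nu φ => .nu φ.tgt
  | rep φ => .rep φ.tgt

/-- The reflexivity bound braid of a process. -/
def BoundBraid.refl : Proc → BoundBraid
  | .zero => zero
  | .inp x P => inp x P
  | .out x y P => out x y P
  | .sum P Q => sumL (refl P) Q
  | .par P Q => par (refl P) (refl Q)
  | .nu P => nu (refl P)
  | .rep P => rep (refl P)

/-- The action of a renaming on bound braids. -/
def BoundBraid.ren : (ℕ → ℕ) → BoundBraid → BoundBraid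
  | ρ, nuSwap R => nuSwap (R.ren (lift (lift ρ)))
  | _, zero => zero
  | ρ, inp x P => inp (ρ x) (P.ren (lift ρ))
  | ρ, out x y P => out (ρ x) (ρ y) (P.ren ρ)
  | ρ, sumL φ Q => sumL (φ.ren ρ) (Q.ren ρ)
  | ρ, sumR P ψ => sumR (P.ren ρ) (ψ.ren ρ)
  | ρ, par φ ψ => par (φ.ren ρ) (ψ.ren ρ)
  | ρ, nu φ => nu (φ.ren (lift ρ))
  | ρ, rep φ => rep (φ.ren ρ)

/-- Push a bound braid past an action. -/
def BoundBraid.pushBy (a : Act) (φ : BoundBraid) : BoundBraid :=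
  if a.isBound then φ.ren push else φ

/-- `t.resBound φ` is the residual `t / φ` of a transition after a coinitial bound braid (with a dummy value
if they are not coinitial). -/
def Trans.resBound : Trans → BoundBraid → Trans
  | opn (nu t), .nuSwap _ => nu (opn (t.ren swap))
  | nu (opn t), .nuSwap _ => opn (nu (t.ren swap))
  | nu (nu t), .nuSwap _ => nu (nu (t.ren swap))
  | sumL t _, .sumL φ Q => sumL (resBound t φ) Q
  | sumL t _, .sumR _ ψ => sumL t ψ.tgt
  | sumR _ u, .sumR P ψ => sumR P (resBound u ψ)
  | sumR _ u, .sumL φ _ => sumR φ.tgt u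
  | parL t _, .par φ ψ => parL (resBound t φ) ψ.tgt
  | parR _ u, .par φ ψ => parR φ.tgt (resBound u ψ)
  | comL t u, .par φ ψ => comL (resBound t φ) (resBound u ψ)
  | comR t u, .par φ ψ => comR (resBound t φ) (resBound u ψ)
  | nuComL t u, .par φ ψ => nuComL (resBound t φ) (resBound u ψ)
  | nuComR t u, .par φ ψ => nuComR (resBound t φ) (resBound u ψ)
  | opn t, .nu φ => opn (resBound t φ)
  | nu t, .nu φ => nu (resBound t φ)
  | rep t, .rep φ => rep (resBound t (.par φ (.rep φ)))
  | t, _ => t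

/-- `φ.resTrans t` is the residual `φ / t` of a bound braid after a coinitial transition (with a dummy value
if they are not coinitial). -/
def BoundBraid.resTrans : BoundBraid → Trans → BoundBraid
  | nuSwap _, .opn (.nu t) => nu (refl t.tgt)
  | nuSwap _, .nu (.opn t) => nu (refl (t.tgt.ren swap))
  | nuSwap _, .nu (.nu t) =>
      if t.act.isBound then nuSwap (((t.tgt.ren (lift swap)).ren swap).ren (lift swap))
      else nuSwap (t.tgt.ren swap)
  | inp _ P, .inp _ _ => refl P
  | out _ _ P, .out _ _ _ => refl P
  | sumL φ _, .sumL t _ => resTrans φ t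
  | sumR _ _, .sumL t _ => refl t.tgt
  | sumR _ ψ, .sumR _ u => resTrans ψ u
  | sumL _ _, .sumR _ u => refl u.tgt
  | par φ ψ, .parL t _ => par (resTrans φ t) (ψ.pushBy t.act)
  | par φ ψ, .parR _ u => par (φ.pushBy u.act) (resTrans ψ u)
  | par φ ψ, .comL t u => par ((resTrans φ t).ren (pop u.act.sent)) (resTrans ψ u)
  | par φ ψ, .comR t u => par (resTrans φ t) ((resTrans ψ u).ren (pop t.act.sent))
  | par φ ψ, .nuComL t u => nu (par (resTrans φ t) (resTrans ψ u))
  | par φ ψ, .nuComR t u => nu (par (resTrans φ t) (resTrans ψ u))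
  | nu φ, .opn t => resTrans φ t
  | nu φ, .nu t => nu (if t.act.isBound then (resTrans φ t).ren swap else resTrans φ t)
  | rep φ, .rep t => resTrans (.par φ (.rep φ)) t
  | φ, _ => φ
termination_by structural _ t => t

/-- Braidings: `free Δ R` is the free braid that relates `(swap + Δ) R` to `R`; the other
braidings are the bound braids. -/
inductive Braiding : Type
  | free (Δ : ℕ) (R : Proc)
  | bound (φ : BoundBraid)

/-- The left-hand side of a braiding. -/
def Braiding.src : Braiding → Proc
  | free Δ R => R.ren (liftN swap Δ)
  | bound φ => φ.src

/-- The right-hand side of a braiding. -/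
def Braiding.tgt : Braiding → Proc
  | free _ R => R
  | bound φ => φ.tgt

/-- The residual `t / γ` of a transition after a coinitial braiding. -/
def Trans.resBraid (t : Trans) : Braiding → Trans
  | .free Δ _ => t.ren (liftN swap Δ)
  | .bound φ => t.resBound φ

/-- The residual `γ / t` of a braiding after a coinitial transition. -/
def Braiding.resTrans : Braiding → Trans → Braiding
  | free Δ _, t => free (Δ + t.act.size) (t.tgt.ren (liftN swap (Δ + t.act.size)))
  | bound φ, t => bound (φ.resTrans t)

/-- `IsBraiding t t' γ`: `γ` is a braiding of the form prescribed by the concurrent actions of `t` and `t'`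
that relates the target of `t' / t` to the target of `t / t'`. If both residual actions are bound
(two bound actions which are not extrusions of the same binder), the form is a free braid; in all other cases
it is a bound braid, where equality is included as the reflexivity bound braid. -/
def IsBraiding (t t' : Trans) (γ : Braiding) : Prop :=
  γ.src = (t'.res t).tgt ∧ γ.tgt = (t.res t').tgt ∧
    if (t'.res t).act.isBound ∧ (t.res t').act.isBound then ∃ R, γ = .free 0 R
    else ∃ φ, γ = .bound φ

/-! ### Traces and causal equivalence -/

/-- Raw traces: sequences of transitions, where `nil P` is the empty trace at `P`. -/
inductive RawTrace : Type
  | nil (P : Proc)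
  | cons (t : Trans) (ts : RawTrace)

/-- `ts.Derives P as R`: `ts` is a sequence of composable transitions from `P` to `R` with the sequence
of actions `as`. -/
inductive RawTrace.Derives : RawTrace → Proc → List Act → Proc → Prop
  | nil (P : Proc) : Derives (.nil P) P [] P
  | cons {t : Trans} {ts : RawTrace} {P R S : Proc} {a : Act} {as : List Act} :
      t.Derives P a R → Derives ts R as S → Derives (.cons t ts) P (a :: as) S

/-- The residual `ts / γ` of a trace after a coinitial braiding. -/
def RawTrace.resBraid : RawTrace → Braiding → RawTrace
  | nil _, γ => nil γ.tgt
  | cons t ts, γ => cons (t.resBraid γ) (ts.resBraid (γ.resTrans t))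

/-- Causal equivalence, defined inductively by nil, cons, transposition of concurrent transitions, and
transitivity. Composability of the traces that the rules mention is a side condition. -/
inductive CausalEq : RawTrace → RawTrace → Prop
  | nil (P : Proc) : CausalEq (.nil P) (.nil P)
  | cons {t : Trans} {P R S S' : Proc} {a : Act} {as bs : List Act} {ts us : RawTrace} :
      t.Derives P a R → ts.Derives R as S → us.Derives R bs S' → CausalEq ts us →
      CausalEq (.cons t ts) (.cons t us)
  | swap {t t' : Trans} {P S : Proc} {as : List Act} {ts : RawTrace} {γ : Braiding} :
      Trans.Concurrent P t t' → IsBraiding t t' γ → ts.Derives (t'.res t).tgt as S →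
      CausalEq (.cons t (.cons (t'.res t) ts)) (.cons t' (.cons (t.res t') (ts.resBraid γ)))
  | trans {ts us vs : RawTrace} : CausalEq ts us → CausalEq us vs → CausalEq ts vs

/-- The traces of the processes in the context `Γ`. -/
def Trace (Γ : ℕ) : Type :=
  {ts : RawTrace // ∃ P as R, P.ClosedBy Γ ∧ ts.Derives P as R}

/-- Causal equivalence of the traces of the processes in the context `Γ`. -/
def Trace.CausalEq {Γ : ℕ} (ts us : Trace Γ) : Prop := PiCalculus.CausalEq ts.1 us.1

end PiCalculus

namespace PiCalculus

/-! ### Renamings -/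

/-! Transitivity is a rule, and reflexivity follows from the nil and cons rules by induction on the
trace. The substance is symmetry, and there the only rule that is not visibly symmetric is the
transposition of concurrent transitions, which transports the tail of the trace along a braiding
`γ`.

Every braiding has an inverse of the same kind: `swap` is an involution, so a free braid or a
νν-braid is inverted by renaming its process, and the other bound braids are inverted componentwise.
If `γ` is a braiding of `t, t'`, then `γ.inv` is one of `t', t`. Reading the transposition rule
backwards is therefore the same rule with `t, t'` exchanged and `γ.inv` for `γ`, provided that
transporting a trace along `γ` and then along `γ.inv` gives it back.

That reduces to two facts about a single transition `t` from the source of `γ`: `(t/γ)/γ⁻¹ = t`, and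
`γ⁻¹/(t/γ) = (γ/t)⁻¹`. The second hands the right inverse braiding to the rest of the trace. For
free braids both are computations with renamings. For bound braids they are proved in
`Trans.Derives.boundTransport`, together with well-typedness of the transport; the νν rule is the
critical case, and its subcase of a bound action rests on the braid relation between `swap` and
`lift swap`. No diamond property of residuals is needed, because the transposition rule takes as a
hypothesis that the endpoints of `γ` are the targets of the two residuals. -/

theorem lift_comp (ρ σ : ℕ → ℕ) : lift σ ∘ lift ρ = lift (σ ∘ ρ) := by
  funext x; cases x <;> rfl

theorem lift_id : lift id = id := by
  funext x; cases x <;> rfl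

theorem swap_comp_swap : swap ∘ swap = id := by
  funext x; rcases x with _ | _ | x <;> rfl

theorem lift_comp_push (ρ : ℕ → ℕ) : lift ρ ∘ push = push ∘ ρ := rfl

theorem comp_pop (ρ : ℕ → ℕ) (y : ℕ) : ρ ∘ pop y = pop (ρ y) ∘ lift ρ := by
  funext x; cases x <;> rfl

/-- `lift (lift ρ)` fixes the two names that `swap` exchanges. This makes renaming compatible with
the νν-braid and with the swap in the target of a ν-transition. -/
theorem lift_lift_comp_swap (ρ : ℕ → ℕ) : lift (lift ρ) ∘ swap = swap ∘ lift (lift ρ) := by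
  funext x; rcases x with _ | _ | x <;> rfl

/-- The braid relation for the adjacent transpositions `s = swap` and `r = lift swap`: from `srs =
rsr` and `r² = 1` one gets `srsr = rs`. It is needed when a bound action passes two restrictions, so
that three names are permuted. -/
theorem swap_braid :
    swap ∘ lift swap ∘ swap ∘ lift swap = lift swap ∘ swap := by
  funext x; rcases x with _ | _ | _ | x <;> rfl

theorem liftN_comp_self {ρ : ℕ → ℕ} (h : ρ ∘ ρ = id) (Δ : ℕ) : liftN ρ Δ ∘ liftN ρ Δ = id := by
  induction Δ with
  | zero => exact h
  | succ Δ ih => rw [liftN, lift_comp, ih, lift_id]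

/-- The renaming `ρ + |a|` used after an action `a`. -/
def liftBy (a : Act) (ρ : ℕ → ℕ) : ℕ → ℕ := if a.isBound then lift ρ else ρ

/-- This matches the renaming of targets with the index `Δ + |a|` of a free braid after a
transition. -/
theorem liftBy_liftN (a : Act) (ρ : ℕ → ℕ) (Δ : ℕ) :
    liftBy a (liftN ρ Δ) = liftN ρ (Δ + a.size) := by
  unfold liftBy Act.size
  split <;> rfl

theorem Act.ren_ren (ρ σ : ℕ → ℕ) (a : Act) : (a.ren ρ).ren σ = a.ren (σ ∘ ρ) := by
  cases a <;> rfl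

theorem Proc.ren_ren (ρ σ : ℕ → ℕ) (P : Proc) : (P.ren ρ).ren σ = P.ren (σ ∘ ρ) := by
  induction P generalizing ρ σ <;> simp_all [Proc.ren, lift_comp]

theorem Proc.ren_id (P : Proc) : P.ren id = P := by
  induction P <;> simp_all [Proc.ren, lift_id]

theorem Trans.ren_ren (ρ σ : ℕ → ℕ) (t : Trans) : (t.ren ρ).ren σ = t.ren (σ ∘ ρ) := by
  induction t generalizing ρ σ <;> simp_all [Trans.ren, Proc.ren_ren, lift_comp]

theorem Trans.ren_id (t : Trans) : t.ren id = t := by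
  induction t <;> simp_all [Trans.ren, Proc.ren_id, lift_id]

theorem Proc.ren_swap_swap (P : Proc) : (P.ren swap).ren swap = P := by
  rw [Proc.ren_ren, swap_comp_swap, Proc.ren_id]

theorem Trans.ren_swap_swap (t : Trans) : (t.ren swap).ren swap = t := by
  rw [Trans.ren_ren, swap_comp_swap, Trans.ren_id]

theorem Proc.pushBy_ren (a : Act) (ρ : ℕ → ℕ) (P : Proc) :
    (P.pushBy a).ren (liftBy a ρ) = (P.ren ρ).pushBy (a.ren ρ) := by
  unfold Proc.pushBy liftBy
  rw [Act.isBound_ren]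
  split <;> simp [Proc.ren_ren, lift_comp_push]

theorem Proc.swapBy_ren (a : Act) (ρ : ℕ → ℕ) (P : Proc) :
    (P.swapBy a).ren (lift (liftBy a ρ)) = (P.ren (liftBy a (lift ρ))).swapBy (a.ren ρ) := by
  unfold Proc.swapBy liftBy
  rw [Act.isBound_ren]
  split <;> simp [Proc.ren_ren, lift_lift_comp_swap]

/-- Renaming preserves derivations. -/
theorem Trans.Derives.ren {t : Trans} {P R : Proc} {a : Act} (h : t.Derives P a R) (ρ : ℕ → ℕ) :
    (t.ren ρ).Derives (P.ren ρ) (a.ren ρ) (R.ren (liftBy a ρ)) := by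
  induction h generalizing ρ with
  | inp x P => exact .inp _ _
  | out x y P => exact .out _ _ _
  | sumL Q _ ih => exact .sumL _ (ih ρ)
  | sumR P _ ih => exact .sumR _ (ih ρ)
  | parL Q _ ih =>
    simp only [Proc.ren, Trans.ren, Proc.pushBy_ren]
    exact .parL _ (ih ρ)
  | parR P _ ih =>
    simp only [Proc.ren, Trans.ren, Proc.pushBy_ren]
    exact .parR _ (ih ρ)
  | @comL t u P Q R S x y _ _ iht ihu =>
    have := Derives.comL (iht ρ) (ihu ρ)
    rw [Proc.ren_ren] at this
    simpa [Proc.ren, Trans.ren, Act.ren, Proc.ren_ren, liftBy, Act.isBound, comp_pop] using this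
  | @comR t u P Q R S x y _ _ iht ihu =>
    have := Derives.comR (iht ρ) (ihu ρ)
    rw [Proc.ren_ren] at this
    simpa [Proc.ren, Trans.ren, Act.ren, Proc.ren_ren, liftBy, Act.isBound, comp_pop] using this
  | nuComL _ _ iht ihu => exact .nuComL (iht ρ) (ihu ρ)
  | nuComR _ _ iht ihu => exact .nuComR (iht ρ) (ihu ρ)
  | opn _ ih => exact .opn (ih (lift ρ))
  | @nu t P R a _ ih =>
    have e : (Proc.nu (R.swapBy a)).ren (liftBy a ρ) =
        .nu ((R.ren (liftBy a (lift ρ))).swapBy (a.ren ρ)) := by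
      rw [Proc.ren, Proc.swapBy_ren]
    rw [e, Trans.ren, Proc.ren]
    refine .nu ?_
    have := ih (lift ρ)
    -- Renaming a pushed action by `lift ρ` gives the push of the renamed action, which is the form
    -- of premise that the ν rule requires.
    rw [Act.ren_ren, lift_comp_push, ← Act.ren_ren] at this
    simpa [liftBy, Act.isBound_ren] using this
  | rep _ ih => exact .rep (ih ρ)

/-! ### Bound braids -/

theorem BoundBraid.src_ren (ρ : ℕ → ℕ) (φ : BoundBraid) : (φ.ren ρ).src = φ.src.ren ρ := by
  induction φ generalizing ρ <;>
    simp_all [BoundBraid.ren, BoundBraid.src, Proc.ren, Proc.ren_ren, lift_lift_comp_swap]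

theorem BoundBraid.tgt_ren (ρ : ℕ → ℕ) (φ : BoundBraid) : (φ.ren ρ).tgt = φ.tgt.ren ρ := by
  induction φ generalizing ρ <;> simp_all [BoundBraid.ren, BoundBraid.tgt, Proc.ren]

theorem BoundBraid.src_pushBy (a : Act) (φ : BoundBraid) :
    (φ.pushBy a).src = φ.src.pushBy a := by
  unfold BoundBraid.pushBy Proc.pushBy
  split <;> simp [BoundBraid.src_ren]

theorem BoundBraid.tgt_pushBy (a : Act) (φ : BoundBraid) :
    (φ.pushBy a).tgt = φ.tgt.pushBy a := by
  unfold BoundBraid.pushBy Proc.pushBy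
  split <;> simp [BoundBraid.tgt_ren]

theorem BoundBraid.src_refl (P : Proc) : (BoundBraid.refl P).src = P := by
  induction P <;> simp_all [BoundBraid.refl, BoundBraid.src]

theorem BoundBraid.tgt_refl (P : Proc) : (BoundBraid.refl P).tgt = P := by
  induction P <;> simp_all [BoundBraid.refl, BoundBraid.tgt]

/-- The inverse of a bound braid. -/
def BoundBraid.inv : BoundBraid → BoundBraid
  | nuSwap R => nuSwap (R.ren swap)
  | zero => zero
  | inp x P => inp x P
  | out x y P => out x y P
  | sumL φ Q => sumL φ.inv Q
  | sumR P ψ => sumR P ψ.inv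
  | par φ ψ => par φ.inv ψ.inv
  | nu φ => nu φ.inv
  | rep φ => rep φ.inv

theorem BoundBraid.src_inv (φ : BoundBraid) : φ.inv.src = φ.tgt := by
  induction φ <;>
    simp_all [BoundBraid.inv, BoundBraid.src, BoundBraid.tgt, Proc.ren_swap_swap]

theorem BoundBraid.tgt_inv (φ : BoundBraid) : φ.inv.tgt = φ.src := by
  induction φ <;> simp_all [BoundBraid.inv, BoundBraid.src, BoundBraid.tgt]

theorem BoundBraid.inv_refl (P : Proc) : (BoundBraid.refl P).inv = BoundBraid.refl P := by
  induction P <;> simp_all [BoundBraid.refl, BoundBraid.inv]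

theorem BoundBraid.inv_ren (ρ : ℕ → ℕ) (φ : BoundBraid) : (φ.ren ρ).inv = φ.inv.ren ρ := by
  induction φ generalizing ρ <;>
    simp_all [BoundBraid.ren, BoundBraid.inv, Proc.ren_ren, lift_lift_comp_swap]

theorem BoundBraid.inv_pushBy (a : Act) (φ : BoundBraid) :
    (φ.pushBy a).inv = φ.inv.pushBy a := by
  unfold BoundBraid.pushBy
  split <;> simp [BoundBraid.inv_ren]

/-! ### Transport along bound braids -/

/-- Transport of a transition `t : P —a→ R` along a bound braid `φ` from `P` yields a transition with
the same action and a bound braid from `R`, and is undone by transport along the inverse of `φ`. -/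
structure BoundTransport (t : Trans) (a : Act) (R : Proc) (φ : BoundBraid) : Prop where
  derives : (t.resBound φ).Derives φ.tgt a (φ.resTrans t).tgt
  src_resTrans : (φ.resTrans t).src = R
  resBound_inv : (t.resBound φ).resBound φ.inv = t
  inv_resTrans : φ.inv.resTrans (t.resBound φ) = (φ.resTrans t).inv

/-- Exchanging the two binders changes which of them is opened: the extruded name has index 1 under
both binders before the swap and index 0 after it. Hence `opn (nu _)` becomes `nu (opn _)`, and the
targets agree on the nose, so the residual braid is reflexivity. -/
theorem BoundTransport.opn_nuSwap {t : Trans} {P R : Proc} {x : ℕ}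
    (h : t.Derives (.nu (P.ren swap)) (.out (x + 1) 0) R) :
    BoundTransport (.opn t) (.bout x) R (.nuSwap P) := by
  -- The `opn` rule yields a bound output, so a plain output of a restriction can come only from the
  -- `nu` rule.
  cases h with
  | @nu t _ R _ h =>
    have hs := h.ren swap
    rw [Proc.ren_swap_swap] at hs
    have hR : Proc.nu (R.swapBy (.out (x + 1) 0)) = .nu R := rfl
    have ht : (t.ren swap).tgt = R.ren swap := hs.tgt_eq
    rw [hR]
    constructor
    · have := Trans.Derives.nu (a := .bout x) (Trans.Derives.opn (x := x + 1) hs)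
      -- The bound output now crosses the outer ν, whose swap cancels the one introduced by the
      -- transport.
      rw [show (R.ren (liftBy ((Act.out (x + 1) 0).ren push) swap)).swapBy (.bout x) = R
        from Proc.ren_swap_swap R] at this
      simpa [Trans.resBound, BoundBraid.resTrans, BoundBraid.tgt, BoundBraid.tgt_refl, h.tgt_eq]
        using this
    · simp [BoundBraid.resTrans, BoundBraid.src, BoundBraid.src_refl, h.tgt_eq]
    · simp [Trans.resBound, BoundBraid.inv, Trans.ren_swap_swap]
    · simp [Trans.resBound, BoundBraid.resTrans, BoundBraid.inv, BoundBraid.inv_refl, ht,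
        h.tgt_eq, Proc.ren_swap_swap]

/-- A twice pushed action mentions neither of the names 0 and 1, so transport through νν preserves
the action. -/
theorem Act.ren_push_push_swap (a : Act) :
    ((a.ren push).ren push).ren swap = (a.ren push).ren push := by
  cases a <;> rfl

theorem Proc.swapBy_nu_swapBy (a : Act) (R : Proc) :
    (Proc.nu (R.swapBy a)).swapBy a =
      .nu (if a.isBound then (R.ren swap).ren (lift swap) else R) := by
  unfold Proc.swapBy
  split <;> rfl

/-- The left-hand side is the body of the source of the residual of `nuSwap` after a bound action;
the right-hand side is the body of the target of the original transition. -/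
theorem Proc.ren_swap_braid (R : Proc) :
    ((((R.ren (lift swap)).ren swap).ren (lift swap)).ren swap) =
      (R.ren swap).ren (lift swap) := by
  simp only [Proc.ren_ren]
  rw [← swap_braid]

theorem BoundTransport.nu_nuSwap {t : Trans} {P R : Proc} {a : Act}
    (h : t.Derives (.nu (P.ren swap)) (a.ren push) R) :
    BoundTransport (.nu t) a (.nu (R.swapBy a)) (.nuSwap P) := by
  generalize hb : a.ren push = b at h
  cases h with
  | @opn t _ R y h =>
    -- The inner binder is extruded and the outer one is crossed; this is the mirror image of
    -- `opn_nuSwap`.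
    obtain ⟨x, rfl, rfl⟩ : ∃ x, a = .bout x ∧ y = x + 1 := by
      cases a <;> simp_all [Act.ren, push]
    have hs := h.ren swap
    rw [Proc.ren_swap_swap] at hs
    have ht : (t.ren swap).tgt = R.ren swap := hs.tgt_eq
    have hR : R.swapBy (.bout x) = R.ren swap := rfl
    rw [hR]
    constructor
    · have := Trans.Derives.opn (Trans.Derives.nu (a := .out (x + 1) 0) hs)
      simpa [Trans.resBound, BoundBraid.resTrans, BoundBraid.tgt, BoundBraid.tgt_refl, h.tgt_eq,
        Proc.swapBy, liftBy, Act.isBound] using this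
    · simp [BoundBraid.resTrans, BoundBraid.src, BoundBraid.src_refl, h.tgt_eq]
    · simp [Trans.resBound, BoundBraid.inv, Trans.ren_swap_swap]
    · simp [Trans.resBound, BoundBraid.resTrans, BoundBraid.inv, BoundBraid.inv_refl, ht,
        h.tgt_eq]
  | @nu t _ R _ h =>
    subst hb
    have hs := h.ren swap
    rw [Proc.ren_swap_swap, Act.ren_push_push_swap] at hs
    have hab : (R.swapBy (a.ren push)) = R.swapBy a := by
      simp [Proc.swapBy, Act.isBound_ren]
    rw [hab, Proc.swapBy_nu_swapBy]
    have hd := Trans.Derives.nu (Trans.Derives.nu hs)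
    rw [show ∀ S : Proc, S.swapBy (a.ren push) = S.swapBy a from fun S => by
      simp [Proc.swapBy, Act.isBound_ren], Proc.swapBy_nu_swapBy] at hd
    -- A bound action adds a third name and both restrictions insert a swap, so the endpoints match
    -- only by the braid relation. Otherwise no swaps are inserted and the involutivity of `swap`
    -- suffices.
    by_cases hba : a.isBound = true
    · have ht : (t.ren swap).tgt = R.ren (lift swap) := by
        rw [hs.tgt_eq]; simp [liftBy, Act.isBound_ren, hba]
      constructor
      · simpa [Trans.resBound, BoundBraid.resTrans, BoundBraid.tgt, h.tgt_eq, h.act_eq,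
          Act.isBound_ren, hba, liftBy] using hd
      · simp [BoundBraid.resTrans, BoundBraid.src, h.tgt_eq, h.act_eq, Act.isBound_ren, hba,
          Proc.ren_swap_braid]
      · simp [Trans.resBound, BoundBraid.inv, Trans.ren_swap_swap]
      · have hl : lift swap ∘ lift swap = id := by rw [lift_comp, swap_comp_swap, lift_id]
        have hll : (R.ren (lift swap)).ren (lift swap) = R := by
          rw [Proc.ren_ren, hl, Proc.ren_id]
        simp [Trans.resBound, BoundBraid.resTrans, BoundBraid.inv, ht, hs.act_eq, h.act_eq,
          h.tgt_eq, Act.isBound_ren, hba, hll, Proc.ren_swap_braid]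
    · have ht : (t.ren swap).tgt = R.ren swap := by
        rw [hs.tgt_eq]; simp [liftBy, Act.isBound_ren, hba]
      constructor
      · simpa [Trans.resBound, BoundBraid.resTrans, BoundBraid.tgt, h.tgt_eq, h.act_eq,
          Act.isBound_ren, hba, liftBy] using hd
      · simp [BoundBraid.resTrans, BoundBraid.src, h.tgt_eq, h.act_eq, Act.isBound_ren, hba,
          Proc.ren_swap_swap]
      · simp [Trans.resBound, BoundBraid.inv, Trans.ren_swap_swap]
      · simp [Trans.resBound, BoundBraid.resTrans, BoundBraid.inv, ht, hs.act_eq, h.act_eq,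
          h.tgt_eq, Act.isBound_ren, hba]

/-- The induction is on the derivation, with the braid arbitrary: under replication the braid grows
from `φ` to `φ ∣ !φ`, while the derivation shrinks. The four properties go together, since the
inverse law for residual braids uses that the transported transition keeps its action. -/
theorem Trans.Derives.boundTransport {t : Trans} {P R : Proc} {a : Act} (h : t.Derives P a R)
    {φ : BoundBraid} (hφ : φ.src = P) : BoundTransport t a R φ := by
  induction h generalizing φ with
  | inp x P =>
    cases φ <;> cases hφ
    exact ⟨by rw [BoundBraid.resTrans, BoundBraid.tgt_refl]; exact .inp x P, BoundBraid.src_refl P,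
      rfl, (BoundBraid.inv_refl P).symm⟩
  | out x y P =>
    cases φ <;> cases hφ
    exact ⟨by rw [BoundBraid.resTrans, BoundBraid.tgt_refl]; exact .out x y P,
      BoundBraid.src_refl P, rfl, (BoundBraid.inv_refl P).symm⟩
  | @sumL t P R a Q h ih =>
    cases φ <;> cases hφ
    · obtain ⟨h1, h2, h3, h4⟩ := ih rfl
      exact ⟨.sumL _ h1, h2, congrArg (Trans.sumL · _) h3, h4⟩
    -- The braid lies in the summand that the transition discards, so it leaves only a reflexivity
    -- braid, which is its own inverse.
    · refine ⟨?_, ?_, ?_, ?_⟩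
      · rw [BoundBraid.resTrans, BoundBraid.tgt_refl, h.tgt_eq]
        exact .sumL _ h
      · rw [BoundBraid.resTrans, BoundBraid.src_refl, h.tgt_eq]
      · simp [Trans.resBound, BoundBraid.inv, BoundBraid.tgt_inv]
      · simp [Trans.resBound, BoundBraid.resTrans, BoundBraid.inv, BoundBraid.inv_refl]
  | @sumR u Q S a P h ih =>
    cases φ <;> cases hφ
    · refine ⟨?_, ?_, ?_, ?_⟩
      · rw [BoundBraid.resTrans, BoundBraid.tgt_refl, h.tgt_eq]
        exact .sumR _ h
      · rw [BoundBraid.resTrans, BoundBraid.src_refl, h.tgt_eq]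
      · simp [Trans.resBound, BoundBraid.inv, BoundBraid.tgt_inv]
      · simp [Trans.resBound, BoundBraid.resTrans, BoundBraid.inv, BoundBraid.inv_refl]
    · obtain ⟨h1, h2, h3, h4⟩ := ih rfl
      exact ⟨.sumR _ h1, h2, congrArg (Trans.sumR _) h3, h4⟩
  | @parL t P R a Q h ih =>
    cases φ <;> cases hφ
    obtain ⟨h1, h2, h3, h4⟩ := ih rfl
    refine ⟨?_, ?_, ?_, ?_⟩
    · simp only [BoundBraid.resTrans, BoundBraid.tgt, BoundBraid.tgt_pushBy, h.act_eq]
      exact .parL _ h1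
    · rw [BoundBraid.resTrans, BoundBraid.src, BoundBraid.src_pushBy, h.act_eq, h2]
    · simp [Trans.resBound, BoundBraid.inv, BoundBraid.tgt_inv, h3]
    · simp [Trans.resBound, BoundBraid.resTrans, BoundBraid.inv, BoundBraid.inv_pushBy, h4,
        h1.act_eq, h.act_eq]
  | @parR u Q S a P h ih =>
    cases φ <;> cases hφ
    obtain ⟨h1, h2, h3, h4⟩ := ih rfl
    refine ⟨?_, ?_, ?_, ?_⟩
    · simp only [BoundBraid.resTrans, BoundBraid.tgt, BoundBraid.tgt_pushBy, h.act_eq]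
      exact .parR _ h1
    · rw [BoundBraid.resTrans, BoundBraid.src, BoundBraid.src_pushBy, h.act_eq, h2]
    · simp [Trans.resBound, BoundBraid.inv, BoundBraid.tgt_inv, h3]
    · simp [Trans.resBound, BoundBraid.resTrans, BoundBraid.inv, BoundBraid.inv_pushBy, h4,
        h1.act_eq, h.act_eq]
  | comL h h' iht ihu =>
    cases φ <;> cases hφ
    obtain ⟨h1, h2, h3, h4⟩ := iht rfl
    obtain ⟨k1, k2, k3, k4⟩ := ihu rfl
    refine ⟨?_, ?_, ?_, ?_⟩
    · simp only [BoundBraid.resTrans, BoundBraid.tgt, BoundBraid.tgt_ren, h'.act_eq]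
      exact .comL h1 k1
    · rw [BoundBraid.resTrans, BoundBraid.src, BoundBraid.src_ren, h'.act_eq, h2, k2]
      rfl
    · simp [Trans.resBound, BoundBraid.inv, h3, k3]
    · simp [Trans.resBound, BoundBraid.resTrans, BoundBraid.inv, BoundBraid.inv_ren, h4, k4,
        k1.act_eq, h'.act_eq]
  | comR h h' iht ihu =>
    cases φ <;> cases hφ
    obtain ⟨h1, h2, h3, h4⟩ := iht rfl
    obtain ⟨k1, k2, k3, k4⟩ := ihu rfl
    refine ⟨?_, ?_, ?_, ?_⟩
    · simp only [BoundBraid.resTrans, BoundBraid.tgt, BoundBraid.tgt_ren, h.act_eq]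
      exact .comR h1 k1
    · rw [BoundBraid.resTrans, BoundBraid.src, BoundBraid.src_ren, h.act_eq, h2, k2]
      rfl
    · simp [Trans.resBound, BoundBraid.inv, h3, k3]
    · simp [Trans.resBound, BoundBraid.resTrans, BoundBraid.inv, BoundBraid.inv_ren, h4, k4,
        h1.act_eq, h.act_eq]
  | nuComL _ _ iht ihu =>
    cases φ <;> cases hφ
    obtain ⟨h1, h2, h3, h4⟩ := iht rfl
    obtain ⟨k1, k2, k3, k4⟩ := ihu rfl
    refine ⟨.nuComL h1 k1, ?_, ?_, ?_⟩
    · simp [BoundBraid.resTrans, BoundBraid.src, h2, k2]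
    · simp [Trans.resBound, BoundBraid.inv, h3, k3]
    · simp [Trans.resBound, BoundBraid.resTrans, BoundBraid.inv, h4, k4]
  | nuComR _ _ iht ihu =>
    cases φ <;> cases hφ
    obtain ⟨h1, h2, h3, h4⟩ := iht rfl
    obtain ⟨k1, k2, k3, k4⟩ := ihu rfl
    refine ⟨.nuComR h1 k1, ?_, ?_, ?_⟩
    · simp [BoundBraid.resTrans, BoundBraid.src, h2, k2]
    · simp [Trans.resBound, BoundBraid.inv, h3, k3]
    · simp [Trans.resBound, BoundBraid.resTrans, BoundBraid.inv, h4, k4]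
  | @opn t P R x h ih =>
    cases φ <;> cases hφ
    · exact .opn_nuSwap h
    · rename_i φ
      obtain ⟨h1, h2, h3, h4⟩ := ih rfl
      -- These equations are used both for `φ` and for `φ.inv` with the transported transition.
      have e : ∀ (t : Trans) (φ : BoundBraid), (Trans.opn t).resBound (.nu φ) = 
          .opn (t.resBound φ) :=
        fun t φ => by simp [Trans.resBound]
      have e' : ∀ (t : Trans) (φ : BoundBraid), (BoundBraid.nu φ).resTrans (.opn t) = 
          φ.resTrans t :=
        fun t φ => by simp [BoundBraid.resTrans]
      refine ⟨?_, ?_, ?_, ?_⟩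
      · rw [e, e']; exact .opn h1
      · rw [e', h2]
      · rw [e, BoundBraid.inv, e, h3]
      · rw [e, BoundBraid.inv, e', e', h4]
  | @nu t P R a h ih =>
    cases φ <;> cases hφ
    · exact .nu_nuSwap h
    · rename_i φ
      obtain ⟨h1, h2, h3, h4⟩ := ih rfl
      have e : ∀ (t : Trans) (φ : BoundBraid), (Trans.nu t).resBound (.nu φ) = 
          .nu (t.resBound φ) :=
        fun t φ => by simp [Trans.resBound]
      have e' : ∀ (t : Trans) (φ : BoundBraid), (BoundBraid.nu φ).resTrans (.nu t) =
          .nu (if t.act.isBound then (φ.resTrans t).ren swap else φ.resTrans t) :=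
        fun t φ => by simp [BoundBraid.resTrans]
      refine ⟨?_, ?_, ?_, ?_⟩
      · have := Trans.Derives.nu h1
        rw [e, e', h.act_eq, Act.isBound_ren]
        unfold Proc.swapBy at this
        split at this <;> simp [BoundBraid.tgt, BoundBraid.tgt_ren, *]
      · rw [e', h.act_eq, Act.isBound_ren]
        unfold Proc.swapBy
        split <;> simp [BoundBraid.src, BoundBraid.src_ren, h2]
      · rw [e, BoundBraid.inv, e, h3]
      · rw [e, BoundBraid.inv, e', e', h4, h1.act_eq, h.act_eq, BoundBraid.inv]
        split <;> simp [BoundBraid.inv_ren]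
  | rep h ih =>
    cases φ <;> cases hφ
    rename_i φ
    -- The premise starts at the unfolding of the replication, so the braid is unfolded as well.
    obtain ⟨h1, h2, h3, h4⟩ := ih (φ := .par φ (.rep φ)) rfl
    have e : ∀ (t : Trans) (φ : BoundBraid), (Trans.rep t).resBound (.rep φ) =
        .rep (t.resBound (.par φ (.rep φ))) := fun t φ => by simp [Trans.resBound]
    have e' : ∀ (t : Trans) (φ : BoundBraid), (BoundBraid.rep φ).resTrans (.rep t) =
        (BoundBraid.par φ (.rep φ)).resTrans t := fun t φ => by simp [BoundBraid.resTrans]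
    simp only [BoundBraid.inv] at h3 h4
    refine ⟨?_, ?_, ?_, ?_⟩
    · rw [e, e']; exact .rep h1
    · rw [e', h2]
    · rw [e, BoundBraid.inv, e, h3]
    · rw [e, BoundBraid.inv, e', e', h4]

/-! ### Transport along braidings -/

/-- The inverse of a braiding. -/
def Braiding.inv : Braiding → Braiding
  | free Δ R => free Δ (R.ren (liftN swap Δ))
  | bound φ => bound φ.inv

theorem Proc.ren_liftN_swap (Δ : ℕ) (P : Proc) :
    (P.ren (liftN swap Δ)).ren (liftN swap Δ) = P := by
  rw [Proc.ren_ren, liftN_comp_self swap_comp_swap, Proc.ren_id]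

theorem Trans.ren_liftN_swap (Δ : ℕ) (t : Trans) :
    (t.ren (liftN swap Δ)).ren (liftN swap Δ) = t := by
  rw [Trans.ren_ren, liftN_comp_self swap_comp_swap, Trans.ren_id]

theorem Braiding.src_inv (γ : Braiding) : γ.inv.src = γ.tgt := by
  cases γ with
  | free Δ R => exact Proc.ren_liftN_swap Δ R
  | bound φ => exact φ.src_inv

theorem Braiding.tgt_inv (γ : Braiding) : γ.inv.tgt = γ.src := by
  cases γ with
  | free Δ R => rfl
  | bound φ => exact φ.tgt_inv

/-- A free braid renames the action, unlike a bound one; hence the existential action. -/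
theorem Trans.Derives.resBraid {t : Trans} {a : Act} {R : Proc} {γ : Braiding}
    (h : t.Derives γ.src a R) :
    ∃ b, (t.resBraid γ).Derives γ.tgt b (γ.resTrans t).tgt := by
  cases γ with
  | free Δ S =>
    have := h.ren (liftN swap Δ)
    rw [liftBy_liftN] at this
    simp only [Braiding.src, Proc.ren_liftN_swap] at this
    refine ⟨a.ren (liftN swap Δ), ?_⟩
    simpa [Trans.resBraid, Braiding.tgt, Braiding.resTrans, h.tgt_eq, h.act_eq] using this
  | bound φ => exact ⟨a, (h.boundTransport rfl).derives⟩

theorem Trans.Derives.src_resTrans {t : Trans} {a : Act} {R : Proc} {γ : Braiding}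
    (h : t.Derives γ.src a R) : (γ.resTrans t).src = R := by
  cases γ with
  | free Δ S => simp [Braiding.resTrans, Braiding.src, h.tgt_eq, Proc.ren_liftN_swap]
  | bound φ => exact (h.boundTransport rfl).src_resTrans

theorem Trans.Derives.resBraid_inv {t : Trans} {a : Act} {R : Proc} {γ : Braiding}
    (h : t.Derives γ.src a R) : (t.resBraid γ).resBraid γ.inv = t := by
  cases γ with
  | free Δ S => exact t.ren_liftN_swap Δ
  | bound φ => exact (h.boundTransport rfl).resBound_inv

theorem Trans.Derives.inv_resTrans {t : Trans} {a : Act} {R : Proc} {γ : Braiding}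
    (h : t.Derives γ.src a R) : γ.inv.resTrans (t.resBraid γ) = (γ.resTrans t).inv := by
  cases γ with
  | free Δ S =>
    have hr := h.ren (liftN swap Δ)
    rw [liftBy_liftN] at hr
    -- Both residual free braids have the same index because renaming does not change whether an
    -- action is bound.
    have hs : (a.ren (liftN swap Δ)).size = a.size := by simp [Act.size, Act.isBound_ren]
    simp [Braiding.resTrans, Braiding.inv, Trans.resBraid, hr.tgt_eq, hr.act_eq, h.tgt_eq,
      h.act_eq, hs]
  | bound φ => exact congrArg Braiding.bound (h.boundTransport rfl).inv_resTrans

theorem RawTrace.Derives.resBraid {ts : RawTrace} {P R : Proc} {as : List Act}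
    (h : ts.Derives P as R) {γ : Braiding} (hγ : γ.src = P) :
    ∃ bs S, (ts.resBraid γ).Derives γ.tgt bs S := by
  induction h generalizing γ with
  | nil P => exact ⟨_, _, .nil _⟩
  | cons ht _ ih =>
    subst hγ
    obtain ⟨b, hb⟩ := ht.resBraid
    obtain ⟨bs, S, hs⟩ := ih ht.src_resTrans
    exact ⟨_, _, .cons hb hs⟩

/-- The head is restored by the inverse law for transitions. The tail then meets the residual of the
inverse, which is the inverse of the residual, so the induction applies with that new braiding. -/
theorem RawTrace.Derives.resBraid_inv {ts : RawTrace} {P R : Proc} {as : List Act}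
    (h : ts.Derives P as R) {γ : Braiding} (hγ : γ.src = P) :
    (ts.resBraid γ).resBraid γ.inv = ts := by
  induction h generalizing γ with
  | nil P => rw [RawTrace.resBraid, RawTrace.resBraid, γ.tgt_inv, hγ]
  | cons ht _ ih =>
    subst hγ
    rw [RawTrace.resBraid, RawTrace.resBraid, ht.resBraid_inv, ht.inv_resTrans, ih ht.src_resTrans]

/-! ### Causal equivalence -/

theorem Trans.Concurrent.symm {P : Proc} {t t' : Trans} (h : Trans.Concurrent P t t') :
    Trans.Concurrent P t' t := ⟨h.2.1, h.1, .symm h.2.2⟩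

/-- The condition that selects free or bound is symmetric in `t` and `t'`, and inversion preserves
both the kind of a braiding and the index `Δ = 0`. -/
theorem IsBraiding.inv {t t' : Trans} {γ : Braiding} (h : IsBraiding t t' γ) :
    IsBraiding t' t γ.inv := by
  obtain ⟨h1, h2, h3⟩ := h
  refine ⟨γ.src_inv.trans h2, γ.tgt_inv.trans h1, ?_⟩
  split at h3 <;> rename_i hb <;> rw [and_comm] at hb
  · obtain ⟨R, rfl⟩ := h3
    rw [if_pos hb]
    exact ⟨_, rfl⟩
  · obtain ⟨φ, rfl⟩ := h3
    rw [if_neg hb]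
    exact ⟨_, rfl⟩

theorem CausalEq.refl {ts : RawTrace} {P R : Proc} {as : List Act} (h : ts.Derives P as R) :
    CausalEq ts ts := by
  induction h with
  | nil P => exact .nil P
  | cons ht hs ih => exact .cons ht hs hs ih

theorem CausalEq.symm {ts us : RawTrace} (h : CausalEq ts us) : CausalEq us ts := by
  induction h with
  | nil P => exact .nil P
  | cons ht hs hu _ ih => exact .cons ht hu hs ih
  | trans _ _ ih ih' => exact .trans ih' ih
  | swap hc hγ hs =>
    obtain ⟨bs, S, hd⟩ := hs.resBraid hγ.1
    -- The reversed transposition is applied to the transported tail, whose composability is `hd`.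
    -- It returns that tail transported along `γ.inv`, which is the original one.
    have := CausalEq.swap hc.symm hγ.inv (hγ.2.1 ▸ hd)
    rwa [hs.resBraid_inv hγ.1] at this

end PiCalculus

theorem mainTheorem4 (Γ : ℕ) : Equivalence (PiCalculus.Trace.CausalEq (Γ := Γ)) := by
  refine ⟨fun ts => ?_, fun h => PiCalculus.CausalEq.symm h, 
    fun h h' => PiCalculus.CausalEq.trans h h'⟩
  -- Reflexivity needs the composability of the trace, since the cons rule demands it.
  obtain ⟨_, _, _, _, h⟩ := ts.2
  exact PiCalculus.CausalEq.refl h
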